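/- Consider an initially straight, axially inextensible cantilever of length $L>0$ and bending stiffness $EI>0$, clamped at its right end $x=L$ and loaded at its free left end $x=0$ by a force of magnitude $F\ge 0$ inclined by the angle $\alpha\in[0,\pi)$ to the beam axis, without end moment. An equilibrium state consists of a rotation $\varphi$ and centerline displacements $u_s,w_s$ on $[0,L]$ with $$EI\,\varphi'=F\cos\alpha\,(w_s-w_s(0))-F\sin\alpha\,(x+u_s-u_s(0)),\qquad u_s'=\cos\varphi-1,\qquad w_s'=-\sin\varphi,$$ $$\varphi(L)=u_s(L)=w_s(L)=0 .$$ Let $\mathrm{F_J}(\varphi,k)=\int_0^\varphi\frac{dt}{\sqrt{1-k^2\sin^2t}}$, $\mathrm{E_J}(\varphi,k)=\int_0^\varphi\sqrt{1-k^2\sin^2t}\,dt$, $\mathrm K(k)=\mathrm{F_J}(\pi/2,k)$, $\mathrm E(k)=\mathrm{E_J}(\pi/2,k)$, and, with $\theta(\varphi)=\arcsin\sqrt{\frac{1-\cos\alpha}{1-\cos(\alpha+\varphi)}}$, $$B(\varphi)=\mathrm K\!\left(\sin\tfrac{\alpha+\varphi}2\right)-\mathrm{F_J}\!\left(\theta(\varphi),\sin\tfrac{\alpha+\varphi}2\right),\qquad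 D(\varphi)=\mathrm{E_J}\!\left(\theta(\varphi),\sin\tfrac{\alpha+\varphi}2\right).$$ (1) For every equilibrium state whose curvature $\varphi'$ is negative on $(0,L]$, the end rotation $\varphi_a=\varphi(0)$ satisfies $\varphi_a>0$, $\alpha+\varphi_a<\pi$ and $B(\varphi_a)>0$, and $$L\sqrt{F/EI}=B(\varphi_a),\qquad F=\frac{EI}{L^2}B(\varphi_a)^2,$$ $$u_a=u_s(0)=L(1+\cos\alpha)-\frac{L\sin\alpha}{B(\varphi_a)}\sqrt{2\cos\alpha-2\cos(\alpha+\varphi_a)}-\frac{2L\cos\alpha}{B(\varphi_a)}\left(\mathrm E\!\left(\sin\tfrac{\alpha+\varphi_a}2\right)-D(\varphi_a)\right),$$ $$w_a=w_s(0)=L\sin\alpha+\frac{L\cos\alpha}{B(\varphi_a)}\sqrt{2\cos\alpha-2\cos(\alpha+\varphi_a)}-\frac{2L\sin\alpha}{B(\varphi_a)}\left(\mathrm E\!\left(\sin\tfrac{\alpha+\varphi_a}2\right)-D(\varphi_a)\right),$$ $$u_F=u_a\cos\alpha+w_a\sin\alpha=L(1+\cos\alpha)-\frac{2L}{B(\varphi_a)}\left(\mathrm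 E\!\left(\sin\tfrac{\alpha+\varphi_a}2\right)-D(\varphi_a)\right).$$ (2) These states are parametrized by the end rotation: for $\varphi_a>0$ with $\alpha+\varphi_a<\pi$ and $F\ge0$, an equilibrium state under the force $F$ with negative curvature on $(0,L]$ and $\varphi(0)=\varphi_a$ exists if and only if $F=\frac{EI}{L^2}B(\varphi_a)^2$. (3) For axial compression, $\alpha=0$, one has $B(\varphi)=\mathrm K(\sin\frac\varphi2)$ and $D(\varphi)=0$ for $0<\varphi<\pi$, and the relations in (1) become $$F=\frac{EI}{L^2}\mathrm K^2\!\left(\sin\tfrac{\varphi_a}2\right),\qquad u_a=2L\left(1-\frac{\mathrm E(\sin\frac{\varphi_a}2)}{\mathrm K(\sin\frac{\varphi_a}2)}\right),\qquad w_a=\frac{2L\sin\frac{\varphi_a}2}{\mathrm K(\sin\frac{\varphi_a}2)} .$$ These three expressions are continuous at $\varphi_a=0$; since $\mathrm K(0)=\mathrm E(0)=\pi/2$, their values there are the Euler critical force $F=\frac{\pi^2EI}{4L^2}$ and zero displacements $u_a=w_a=0$. -/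

import Mathlib

noncomputable section

/-- Incomplete elliptic integral of the first kind, `F_J(φ, k)`. -/
def ellipticFJ (φ k : ℝ) : ℝ :=
  ∫ t in (0 : ℝ)..φ, 1 / Real.sqrt (1 - k ^ 2 * Real.sin t ^ 2)

/-- Incomplete elliptic integral of the second kind, `E_J(φ, k)`. -/
def ellipticEJ (φ k : ℝ) : ℝ :=
  ∫ t in (0 : ℝ)..φ, Real.sqrt (1 - k ^ 2 * Real.sin t ^ 2)

/-- Complete elliptic integral of the first kind, `K(k)`. -/
def ellipticK (k : ℝ) : ℝ := ellipticFJ (Real.pi / 2) k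

/-- Complete elliptic integral of the second kind, `E(k)`. -/
def ellipticE (k : ℝ) : ℝ := ellipticEJ (Real.pi / 2) k

/-- Fundamental equations of an initially straight, axially inextensible, shear-rigid elastic beam
of length `L` and bending stiffness `EI`. Here `X`, `Z`, `M` are the left-end forces and the
left-end moment, `φ` is the sectional rotation, and `u`, `w` are the centerline displacements, all
as functions of the initial coordinate `x ∈ [0, L]` (one-sided derivatives at the two ends). -/
structure IsInextensibleBeam (EI L X Z M : ℝ) (φ u w : ℝ → ℝ) : Prop where
  moment : ∀ x ∈ Set.Icc 0 L, HasDerivWithinAt φ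
    ((-M + X * (w x - w 0) - Z * (x + u x - u 0)) / EI) (Set.Icc 0 L) x
  axial : ∀ x ∈ Set.Icc 0 L, HasDerivWithinAt u (Real.cos (φ x) - 1) (Set.Icc 0 L) x
  transversal : ∀ x ∈ Set.Icc 0 L, HasDerivWithinAt w (-Real.sin (φ x)) (Set.Icc 0 L) x

/-- Curvature `κ = φ'` of a beam occupying `[0, L]`. -/
def beamCurvature (L : ℝ) (φ : ℝ → ℝ) (x : ℝ) : ℝ := derivWithin φ (Set.Icc 0 L) x

/-- Equilibrium state of an inextensible cantilever clamped at its right end `x = L` and loaded at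
its left end `x = 0` by a force of magnitude `F` that deviates by the angle `α` from the beam
axis, with no end moment. -/
structure IsCantileverState (EI L α F : ℝ) (φ u w : ℝ → ℝ) : Prop where
  beam : IsInextensibleBeam EI L (F * Real.cos α) (F * Real.sin α) 0 φ u w
  clamped_rotation : φ L = 0
  clamped_axial : u L = 0
  clamped_transversal : w L = 0

/-- The auxiliary function `B(φ)` for the inclination `α`. -/
def cantileverB (α φ : ℝ) : ℝ :=
  ellipticK (Real.sin ((α + φ) / 2)) -
    ellipticFJ (Real.arcsin (Real.sqrt ((1 - Real.cos α) / (1 - Real.cos (α + φ)))))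
      (Real.sin ((α + φ) / 2))

/-- The auxiliary function `D(φ)` for the inclination `α`. -/
def cantileverD (α φ : ℝ) : ℝ :=
  ellipticEJ (Real.arcsin (Real.sqrt ((1 - Real.cos α) / (1 - Real.cos (α + φ)))))
    (Real.sin ((α + φ) / 2))

/-- Closed-form force for axial compression, as a function of the end rotation. -/
def axialForce (EI L φ : ℝ) : ℝ := EI / L ^ 2 * ellipticK (Real.sin (φ / 2)) ^ 2

/-- Closed-form axial end displacement for axial compression. -/
def axialU (L φ : ℝ) : ℝ :=
  2 * L * (1 - ellipticE (Real.sin (φ / 2)) / ellipticK (Real.sin (φ / 2)))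

/-- Closed-form transversal end displacement for axial compression. -/
def axialW (L φ : ℝ) : ℝ :=
  2 * L * Real.sin (φ / 2) / ellipticK (Real.sin (φ / 2))

end

section

open Real Set

/-! Write `p = φ'`, `ω = √(F/EI)`, `k = sin ((α + φ 0) / 2)`. The moment balance gives `p 0 = 0` and
`p' = -ω² sin (α + φ)`, hence the first integral `p² = 2ω² (cos (α + φ) - cos (α + φ 0))`
(`momentCurvature_sq`). Negative curvature makes `φ` decreasing, and the first integral forces `α +
φ 0 < π`. The substitution `sin ((α + φ) / 2) = k sin θ` turns the equation into `θ' = -ω √(1 - k²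
sin² θ)`, with `θ 0 = π / 2`. So `F_J(θ) + ω x` is constant, which gives `L ω = B`. A similar
conserved quantity with `E_J(θ)` gives the end displacement along the force, and the first integral
at `x = L` gives the one across it; rotating by `α` yields `u 0` and `w 0`. Conversely, inverting
`F_J` builds a state for every admissible end rotation (`exists_cantileverState`). -/

theorem eq_of_hasDerivAt_zero {f : ℝ → ℝ} {a b : ℝ} (hab : a ≤ b)
    (hc : ContinuousOn f (Icc a b)) (hd : ∀ x ∈ Ioo a b, HasDerivAt f 0 x) : f a = f b := by
  rcases hab.eq_or_lt with rfl | h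
  · rfl
  obtain ⟨c, -, hs⟩ := exists_hasDerivAt_eq_slope f (fun _ => 0) h hc hd
  rcases div_eq_zero_iff.1 hs.symm with h0 | h0 <;> linarith

/-! ### Elliptic integrals and the Jacobi amplitude -/

theorem one_sub_sq_mul_sin_sq_pos {k : ℝ} (hk : k ^ 2 < 1) (t : ℝ) :
    0 < 1 - k ^ 2 * sin t ^ 2 := by
  nlinarith [sin_sq_le_one t, sq_nonneg k, sq_nonneg (sin t)]

theorem continuous_ellipticFJ_integrand {k : ℝ} (hk : k ^ 2 < 1) :
    Continuous fun t : ℝ => 1 / √(1 - k ^ 2 * sin t ^ 2) :=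
  continuous_const.div (by fun_prop) fun t =>
    (sqrt_pos.2 (one_sub_sq_mul_sin_sq_pos hk t)).ne'

theorem hasDerivAt_ellipticFJ {k : ℝ} (hk : k ^ 2 < 1) (t : ℝ) :
    HasDerivAt (fun s => ellipticFJ s k) (1 / √(1 - k ^ 2 * sin t ^ 2)) t :=
  intervalIntegral.integral_hasDerivAt_right
    ((continuous_ellipticFJ_integrand hk).intervalIntegrable _ _)
    ((continuous_ellipticFJ_integrand hk).stronglyMeasurableAtFilter _ _)
    (continuous_ellipticFJ_integrand hk).continuousAt

theorem hasDerivAt_ellipticEJ (k t : ℝ) :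
    HasDerivAt (fun s => ellipticEJ s k) (√(1 - k ^ 2 * sin t ^ 2)) t := by
  have h : Continuous fun t : ℝ => √(1 - k ^ 2 * sin t ^ 2) := by fun_prop
  exact intervalIntegral.integral_hasDerivAt_right (h.intervalIntegrable _ _)
    (h.stronglyMeasurableAtFilter _ _) h.continuousAt

theorem continuous_ellipticFJ {k : ℝ} (hk : k ^ 2 < 1) :
    Continuous fun s => ellipticFJ s k :=
  continuous_iff_continuousAt.2 fun t => (hasDerivAt_ellipticFJ hk t).continuousAt

theorem continuous_ellipticEJ (k : ℝ) : Continuous fun s => ellipticEJ s k :=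
  continuous_iff_continuousAt.2 fun t => (hasDerivAt_ellipticEJ k t).continuousAt

theorem one_le_ellipticFJ_integrand {k : ℝ} (hk : k ^ 2 < 1) (t : ℝ) :
    1 ≤ 1 / √(1 - k ^ 2 * sin t ^ 2) := by
  rw [le_div_iff₀ (sqrt_pos.2 (one_sub_sq_mul_sin_sq_pos hk t)), one_mul, sqrt_le_one]
  nlinarith [mul_nonneg (sq_nonneg k) (sq_nonneg (sin t))]

/-- The integrand is at least 1. This linear growth yields both strict monotonicity and surjectivity
onto `ℝ`, so the inverse amplitude is defined everywhere. -/
theorem sub_le_ellipticFJ_sub {k : ℝ} (hk : k ^ 2 < 1) {s t : ℝ} (h : s ≤ t) :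
    t - s ≤ ellipticFJ t k - ellipticFJ s k := by
  have hd : ∀ x, HasDerivAt (fun s => ellipticFJ s k - s)
      (1 / √(1 - k ^ 2 * sin x ^ 2) - 1) x := fun x =>
    (hasDerivAt_ellipticFJ hk x).sub (hasDerivAt_id x)
  have := monotone_of_deriv_nonneg (fun x => (hd x).differentiableAt) (fun x => by
    rw [(hd x).deriv]; linarith [one_le_ellipticFJ_integrand hk x]) h
  simp only at this
  linarith

theorem strictMono_ellipticFJ {k : ℝ} (hk : k ^ 2 < 1) :
    StrictMono fun s => ellipticFJ s k := fun s t h => by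
  have := sub_le_ellipticFJ_sub hk h.le
  simp only; linarith

theorem ellipticFJ_zero_left (k : ℝ) : ellipticFJ 0 k = 0 := by simp [ellipticFJ]

theorem ellipticEJ_zero_left (k : ℝ) : ellipticEJ 0 k = 0 := by simp [ellipticEJ]

theorem surjective_ellipticFJ {k : ℝ} (hk : k ^ 2 < 1) :
    Function.Surjective fun s => ellipticFJ s k := by
  refine (continuous_ellipticFJ hk).surjective ?_ ?_
  · refine Filter.tendsto_atTop_mono' _ ?_ Filter.tendsto_id
    filter_upwards [Filter.eventually_ge_atTop 0] with x hx
    have := sub_le_ellipticFJ_sub hk hx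
    rw [ellipticFJ_zero_left] at this
    simp only [id]; linarith
  · refine Filter.tendsto_atBot_mono' _ ?_ Filter.tendsto_id
    filter_upwards [Filter.eventually_le_atBot 0] with x hx
    have := sub_le_ellipticFJ_sub hk hx
    rw [ellipticFJ_zero_left] at this
    simp only [id]; linarith

/-- Existence of the Jacobi amplitude: a differentiable inverse of `F_J(·, k)`. -/
theorem exists_jacobi_amplitude {k : ℝ} (hk : k ^ 2 < 1) :
    ∃ am : ℝ → ℝ, StrictMono am ∧ (∀ t, am (ellipticFJ t k) = t) ∧
      ∀ s, HasDerivAt am (√(1 - k ^ 2 * sin (am s) ^ 2)) s := by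
  let e : ℝ ≃o ℝ := (strictMono_ellipticFJ hk).orderIsoOfSurjective _ (surjective_ellipticFJ hk)
  have he : ∀ t, e t = ellipticFJ t k := fun t => rfl
  refine ⟨e.symm, e.symm.strictMono, fun t => by rw [← he, e.symm_apply_apply], fun s => ?_⟩
  have hpos := sqrt_pos.2 (one_sub_sq_mul_sin_sq_pos hk (e.symm s))
  have := HasDerivAt.of_local_left_inverse (f := fun t => ellipticFJ t k) (g := e.symm) (a := s)
    e.symm.continuous.continuousAt (hasDerivAt_ellipticFJ hk (e.symm s))
    (one_div_pos.2 hpos).ne' (Filter.Eventually.of_forall fun y => by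
      rw [← he, e.apply_symm_apply])
  simpa using this

theorem ellipticK_zero : ellipticK 0 = π / 2 := by simp [ellipticK, ellipticFJ]

theorem ellipticE_zero : ellipticE 0 = π / 2 := by simp [ellipticE, ellipticEJ]

theorem continuous_ellipticE : Continuous ellipticE := by
  unfold ellipticE ellipticEJ
  exact intervalIntegral.continuous_parametric_intervalIntegral_of_continuous' (by fun_prop) _ _

theorem continuousAt_ellipticK_zero : ContinuousAt ellipticK 0 := by
  unfold ellipticK ellipticFJ
  have hev : ∀ᶠ k : ℝ in nhds 0, k ^ 2 < 1 / 2 :=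
    (continuous_pow 2).continuousAt.eventually_lt continuousAt_const (by norm_num)
  refine intervalIntegral.continuousAt_of_dominated_interval (bound := fun _ => 2) ?_ ?_ (by simp) ?_
  · filter_upwards [hev] with k hk
    exact (continuous_ellipticFJ_integrand (by linarith)).aestronglyMeasurable
  · filter_upwards [hev] with k hk
    refine Filter.Eventually.of_forall fun t _ => ?_
    -- The weaker bound 1/4 is used for its rational root; it gives the dominating constant 2.
    have h1 : 1 / 4 ≤ 1 - k ^ 2 * sin t ^ 2 := by
      nlinarith [sin_sq_le_one t, sq_nonneg k, sq_nonneg (sin t)]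
    have h2 : 1 / 2 ≤ √(1 - k ^ 2 * sin t ^ 2) := le_sqrt_of_sq_le (by linarith)
    rw [norm_of_nonneg (by positivity), div_le_iff₀ (by linarith)]
    linarith
  · refine Filter.Eventually.of_forall fun t _ => ?_
    exact continuousAt_const.div (by fun_prop) (by simp)

/-! ### Half-angle forms of `B` and `D` -/

theorem sqrt_one_sub_cos_div {α β : ℝ} (hα : 0 ≤ α) (hα' : α ≤ 2 * π) (hβ : 0 ≤ β)
    (hβ' : β ≤ 2 * π) :
    √((1 - cos α) / (1 - cos β)) = sin (α / 2) / sin (β / 2) := by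
  have key : ∀ x, 1 - cos x = 2 * sin (x / 2) ^ 2 := fun x => by
    rw [sin_sq_eq_half_sub, mul_div_cancel₀ x two_ne_zero]; ring
  rw [key, key, mul_div_mul_left _ _ two_ne_zero, ← div_pow, sqrt_sq]
  exact div_nonneg (sin_nonneg_of_nonneg_of_le_pi (by linarith) (by linarith))
    (sin_nonneg_of_nonneg_of_le_pi (by linarith) (by linarith))

theorem cantileverB_eq {α φ : ℝ} (hα : 0 ≤ α) (hφ : 0 ≤ φ) (h : α + φ ≤ π) :
    cantileverB α φ = ellipticFJ (π / 2) (sin ((α + φ) / 2)) -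
      ellipticFJ (arcsin (sin (α / 2) / sin ((α + φ) / 2))) (sin ((α + φ) / 2)) := by
  rw [cantileverB, ellipticK, sqrt_one_sub_cos_div hα (by linarith) (by linarith)
    (by linarith [pi_pos])]

theorem cantileverD_eq {α φ : ℝ} (hα : 0 ≤ α) (hφ : 0 ≤ φ) (h : α + φ ≤ π) :
    cantileverD α φ =
      ellipticEJ (arcsin (sin (α / 2) / sin ((α + φ) / 2))) (sin ((α + φ) / 2)) := by
  rw [cantileverD, sqrt_one_sub_cos_div hα (by linarith) (by linarith) (by linarith [pi_pos])]

theorem sin_half_pos {ψ : ℝ} (h0 : 0 < ψ) (h : ψ < π) : 0 < sin (ψ / 2) :=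
  sin_pos_of_pos_of_lt_pi (by linarith) (by linarith)

theorem cos_half_pos {ψ : ℝ} (h0 : 0 ≤ ψ) (h : ψ < π) : 0 < cos (ψ / 2) :=
  cos_pos_of_mem_Ioo ⟨by linarith [pi_pos], by linarith⟩

theorem sin_half_sq_lt_one {ψ : ℝ} (h0 : 0 ≤ ψ) (h : ψ < π) : sin (ψ / 2) ^ 2 < 1 := by
  nlinarith [sin_sq_add_cos_sq (ψ / 2), cos_half_pos h0 h]

theorem sin_half_lt {ψ β : ℝ} (h0 : 0 ≤ ψ) (h : ψ < β) (hβ : β < π) :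
    sin (ψ / 2) < sin (β / 2) :=
  sin_lt_sin_of_lt_of_le_pi_div_two (by linarith [pi_pos]) (by linarith) (by linarith)

theorem arcsin_sin_half_div_lt {ψ β : ℝ} (h0 : 0 ≤ ψ) (h : ψ < β) (hβ : β < π) :
    arcsin (sin (ψ / 2) / sin (β / 2)) < π / 2 :=
  arcsin_lt_pi_div_two.2
    ((div_lt_one (sin_half_pos (by linarith) hβ)).2 (sin_half_lt h0 h hβ))

theorem cantileverB_pos {α φ : ℝ} (hα : 0 ≤ α) (hφ : 0 < φ) (h : α + φ < π) :
    0 < cantileverB α φ := by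
  rw [cantileverB_eq hα hφ.le h.le, sub_pos]
  exact strictMono_ellipticFJ (sin_half_sq_lt_one (by linarith) h)
    (arcsin_sin_half_div_lt hα (by linarith) h)

/-! ### Moment balance and first integral -/

/-- Curvature prescribed by the moment balance of a cantilever without end moment. -/
noncomputable def momentCurvature (EI α F : ℝ) (u w : ℝ → ℝ) (x : ℝ) : ℝ :=
  (F * cos α * (w x - w 0) - F * sin α * (x + u x - u 0)) / EI

theorem momentCurvature_zero (EI α F : ℝ) (u w : ℝ → ℝ) : momentCurvature EI α F u w 0 = 0 := by
  simp [momentCurvature]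

theorem hasDerivWithinAt_momentCurvature {EI α F x : ℝ} {φ u w : ℝ → ℝ} {s : Set ℝ}
    (hu : HasDerivWithinAt u (cos (φ x) - 1) s x) (hw : HasDerivWithinAt w (-sin (φ x)) s x) :
    HasDerivWithinAt (momentCurvature EI α F u w) (-(F / EI) * sin (α + φ x)) s x := by
  have := (((hw.sub_const (w 0)).const_mul (F * cos α)).sub
    ((((hasDerivWithinAt_id x s).add hu).sub_const (u 0)).const_mul (F * sin α))).div_const EI
  refine this.congr_deriv ?_
  rw [sin_add]; ring

namespace IsCantileverState

variable {EI L α F : ℝ} {φ u w : ℝ → ℝ}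

theorem hasDerivWithinAt_rotation (h : IsCantileverState EI L α F φ u w) {x : ℝ}
    (hx : x ∈ Icc 0 L) :
    HasDerivWithinAt φ (momentCurvature EI α F u w x) (Icc 0 L) x := by
  have := h.beam.moment x hx
  rwa [neg_zero, zero_add] at this

theorem momentCurvature_neg (h : IsCantileverState EI L α F φ u w)
    (hneg : ∀ x ∈ Ioc 0 L, beamCurvature L φ x < 0) {x : ℝ} (hx : x ∈ Ioc 0 L) :
    momentCurvature EI α F u w x < 0 := by
  have hx' : x ∈ Icc 0 L := Ioc_subset_Icc_self hx
  have := hneg x hx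
  rwa [beamCurvature, (h.hasDerivWithinAt_rotation hx').derivWithin
    (uniqueDiffOn_Icc (hx.1.trans_le hx.2) x hx')] at this

theorem continuousOn_rotation (h : IsCantileverState EI L α F φ u w) :
    ContinuousOn φ (Icc 0 L) := fun _ hx => (h.hasDerivWithinAt_rotation hx).continuousWithinAt

theorem hasDerivAt_rotation (h : IsCantileverState EI L α F φ u w) {x : ℝ} (hx : x ∈ Ioo 0 L) :
    HasDerivAt φ (momentCurvature EI α F u w x) x :=
  (h.hasDerivWithinAt_rotation (Ioo_subset_Icc_self hx)).hasDerivAt (Icc_mem_nhds hx.1 hx.2)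

theorem strictAntiOn_rotation (h : IsCantileverState EI L α F φ u w)
    (hneg : ∀ x ∈ Ioc 0 L, beamCurvature L φ x < 0) : StrictAntiOn φ (Icc 0 L) := by
  refine strictAntiOn_of_deriv_neg (convex_Icc 0 L) h.continuousOn_rotation fun x hx => ?_
  rw [interior_Icc] at hx
  rw [(h.hasDerivAt_rotation hx).deriv]
  exact h.momentCurvature_neg hneg (Ioo_subset_Ioc_self hx)

/-- First integral of the elastica equation. -/
theorem momentCurvature_sq (h : IsCantileverState EI L α F φ u w) {x : ℝ} (hx : x ∈ Icc 0 L) :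
    momentCurvature EI α F u w x ^ 2 = 2 * (F / EI) * (cos (α + φ x) - cos (α + φ 0)) := by
  have hd : ∀ y ∈ Icc 0 L, HasDerivWithinAt
      (fun y => momentCurvature EI α F u w y ^ 2 - 2 * (F / EI) * cos (α + φ y)) 0 (Icc 0 L) y := by
    intro y hy
    refine (((hasDerivWithinAt_momentCurvature (h.beam.axial y hy)
      (h.beam.transversal y hy)).pow 2).sub
      (((h.hasDerivWithinAt_rotation hy).const_add α).cos.const_mul _)).congr_deriv ?_
    push_cast; ring
  have hsub : Icc 0 x ⊆ Icc 0 L := Icc_subset_Icc_right hx.2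
  have := eq_of_hasDerivAt_zero hx.1
    (fun y hy => (hd y (hsub hy)).continuousWithinAt.mono hsub)
    (fun y hy => (hd y (hsub (Ioo_subset_Icc_self hy))).hasDerivAt
      (Icc_mem_nhds hy.1 (hy.2.trans_le hx.2)))
  -- The absence of an end moment fixes the constant of integration.
  simp only [momentCurvature_zero] at this
  linarith

/-! ### Bounds on the end rotation -/

theorem rotation_zero_pos (h : IsCantileverState EI L α F φ u w) (hL : 0 < L)
    (hneg : ∀ x ∈ Ioc 0 L, beamCurvature L φ x < 0) : 0 < φ 0 :=
  h.clamped_rotation.symm.trans_lt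
    (h.strictAntiOn_rotation hneg (left_mem_Icc.2 hL.le) (right_mem_Icc.2 hL.le) hL)

theorem rotation_nonneg (h : IsCantileverState EI L α F φ u w)
    (hneg : ∀ x ∈ Ioc 0 L, beamCurvature L φ x < 0) {x : ℝ} (hx : x ∈ Icc 0 L) : 0 ≤ φ x := by
  rw [← h.clamped_rotation]
  exact (h.strictAntiOn_rotation hneg).antitoneOn hx (right_mem_Icc.2 (hx.1.trans hx.2)) hx.2

theorem force_pos (h : IsCantileverState EI L α F φ u w) (hL : 0 < L) (hF : 0 ≤ F)
    (hneg : ∀ x ∈ Ioc 0 L, beamCurvature L φ x < 0) : 0 < F := by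
  refine hF.lt_of_ne' ?_
  rintro rfl
  have := h.momentCurvature_neg hneg (right_mem_Ioc.2 hL)
  simp [momentCurvature] at this

/-- Here `α + φ 0 = π` would start the beam at a rest point of the pendulum equation, which cannot
be left in finite length: a Grönwall estimate forces `π - (α + φ L) ≤ 0`, whereas this number is `φ
0 > 0`. -/
theorem add_rotation_zero_ne_pi (h : IsCantileverState EI L α F φ u w) (hEI : 0 < EI)
    (hL : 0 < L) (hF : 0 ≤ F) (hneg : ∀ x ∈ Ioc 0 L, beamCurvature L φ x < 0) :
    α + φ 0 ≠ π := by
  intro hπ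
  set ω := √(F / EI) with hω
  have hω2 : ω ^ 2 = F / EI := sq_sqrt (by positivity)
  have hω0 : 0 ≤ ω := sqrt_nonneg _
  have hanti := (h.strictAntiOn_rotation hneg).antitoneOn
  -- `y = π - (α + φ)` satisfies `y' ≤ ω y` and `y(0) = 0`
  have hbound : ∀ x ∈ Ioo 0 L, -momentCurvature EI α F u w x ≤ ω * (π - (α + φ x)) := by
    intro x hx
    have hx' := Ioo_subset_Icc_self hx
    have hy : 0 ≤ π - (α + φ x) := by
      have := hanti (left_mem_Icc.2 hL.le) hx' hx.1.le
      linarith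
    refine abs_le_of_sq_le_sq' ?_ (mul_nonneg hω0 hy) |>.2
    rw [neg_sq, h.momentCurvature_sq hx', hπ, cos_pi, mul_pow, hω2, ← hω2]
    -- With `y = π - (α + φ x)`, the first integral reads `p² = 2ω² (1 - cos y) ≤ ω² y²`.
    have h1 := one_sub_sq_div_two_le_cos (x := π - (α + φ x))
    rw [cos_pi_sub] at h1
    nlinarith [sq_nonneg ω]
  have hmono : AntitoneOn (fun x => (π - (α + φ x)) * exp (-(ω * x))) (Icc 0 L) := by
    refine antitoneOn_of_deriv_nonpos (convex_Icc 0 L) ?_ ?_ ?_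
    · exact ((continuousOn_const.sub (continuousOn_const.add h.continuousOn_rotation)).mul
        (by fun_prop))
    · intro x hx
      rw [interior_Icc] at hx
      have := (h.hasDerivAt_rotation hx).differentiableAt
      exact DifferentiableAt.differentiableWithinAt (by fun_prop)
    · intro x hx
      rw [interior_Icc] at hx
      have hd := (((h.hasDerivAt_rotation hx).const_add α).const_sub π).mul
        (((hasDerivAt_id x).const_mul ω).neg.exp)
      have he := exp_pos (-(ω * x))
      have hb := hbound x hx
      refine (HasDerivAt.deriv hd).trans_le ?_
      simp only [Pi.neg_apply, id, mul_one]
      nlinarith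
  have h1 := hmono (left_mem_Icc.2 hL.le) (right_mem_Icc.2 hL.le) hL.le
  simp only [h.clamped_rotation, hπ, sub_self, zero_mul, add_zero] at h1
  have h2 := h.rotation_zero_pos hL hneg
  have := mul_pos (show 0 < π - α by linarith) (exp_pos (-(ω * L)))
  linarith

/-- Beyond `π`, the angle `α + φ` would pass through `π` at some `x > 0`, where the first integral
gives `p² ≤ 0`, against `p < 0`. -/
theorem add_rotation_zero_lt_pi (h : IsCantileverState EI L α F φ u w) (hEI : 0 < EI)
    (hL : 0 < L) (hF : 0 ≤ F) (hα' : α < π)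
    (hneg : ∀ x ∈ Ioc 0 L, beamCurvature L φ x < 0) : α + φ 0 < π := by
  by_contra! hle
  have hlt : π < α + φ 0 := hle.lt_of_ne' (h.add_rotation_zero_ne_pi hEI hL hF hneg)
  obtain ⟨x, hx, hxπ⟩ : ∃ x ∈ Icc 0 L, φ x = π - α :=
    intermediate_value_Icc' hL.le h.continuousOn_rotation
      ⟨by rw [h.clamped_rotation]; linarith, by linarith⟩
  have hx0 : 0 < x := hx.1.lt_of_ne (by rintro rfl; linarith)
  have hsq := h.momentCurvature_sq hx
  have hlt' := h.momentCurvature_neg hneg ⟨hx0, hx.2⟩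
  rw [hxπ, add_sub_cancel, cos_pi] at hsq
  have : 0 ≤ F / EI := by positivity
  nlinarith [neg_one_le_cos (α + φ 0)]

/-! ### The elastica amplitude -/

/-- Along a state of negative curvature, the curvature in terms of the elastica amplitude. -/
theorem momentCurvature_eq (h : IsCantileverState EI L α F φ u w) (hEI : 0 < EI) (hL : 0 < L)
    (hF : 0 ≤ F) (hα : 0 ≤ α) (hα' : α < π) (hneg : ∀ x ∈ Ioc 0 L, beamCurvature L φ x < 0)
    {x : ℝ} (hx : x ∈ Ioc 0 L) :
    momentCurvature EI α F u w x = -(2 * √(F / EI) * sin ((α + φ 0) / 2) *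
      √(1 - (sin ((α + φ x) / 2) / sin ((α + φ 0) / 2)) ^ 2)) := by
  have hx' : x ∈ Icc 0 L := Ioc_subset_Icc_self hx
  have hπ := h.add_rotation_zero_lt_pi hEI hL hF hα' hneg
  have h0 := h.rotation_zero_pos hL hneg
  have hxnn := h.rotation_nonneg hneg hx'
  have hlt := h.strictAntiOn_rotation hneg (left_mem_Icc.2 hL.le) hx' hx.1
  have hk := sin_half_pos (by linarith) hπ
  have hs := sin_half_lt (ψ := α + φ x) (β := α + φ 0) (by linarith) (by linarith) hπ
  have hs0 : 0 ≤ sin ((α + φ x) / 2) :=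
    sin_nonneg_of_nonneg_of_le_pi (by linarith) (by linarith)
  have h1 : 0 ≤ 1 - (sin ((α + φ x) / 2) / sin ((α + φ 0) / 2)) ^ 2 := by
    have : (sin ((α + φ x) / 2) / sin ((α + φ 0) / 2)) ≤ 1 := (div_le_one hk).2 hs.le
    have := div_nonneg hs0 hk.le
    nlinarith
  rw [eq_neg_iff_add_eq_zero, ← neg_eq_iff_add_eq_zero]
  -- Both sides are nonnegative, so it suffices to compare squares: the first integral in
  -- half-angles.
  refine (pow_left_inj₀ (n := 2) (neg_nonneg.2 (h.momentCurvature_neg hneg hx).le) (by positivity)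
    two_ne_zero).1 ?_
  have key : ∀ x, cos x = 1 - 2 * sin (x / 2) ^ 2 := fun x => by
    rw [sin_sq_eq_half_sub, mul_div_cancel₀ x two_ne_zero]; ring
  rw [neg_sq, h.momentCurvature_sq hx', mul_pow, mul_pow, mul_pow, sq_sqrt h1,
    sq_sqrt (by positivity), key (α + φ x), key (α + φ 0)]
  field_simp
  ring

/-- The elastica amplitude `θ`, with `sin ((α + φ x) / 2) = sin ((α + φ 0) / 2) * sin (θ x)`. -/
noncomputable def _root_.elasticaAmplitude (α : ℝ) (φ : ℝ → ℝ) (x : ℝ) : ℝ :=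
  arcsin (sin ((α + φ x) / 2) / sin ((α + φ 0) / 2))

theorem continuousOn_elasticaAmplitude (h : IsCantileverState EI L α F φ u w) :
    ContinuousOn (elasticaAmplitude α φ) (Icc 0 L) :=
  continuous_arcsin.comp_continuousOn
    ((continuous_sin.comp_continuousOn
      ((continuousOn_const.add h.continuousOn_rotation).div_const 2)).div_const _)

theorem sqrt_elasticaAmplitude (h : IsCantileverState EI L α F φ u w) (hEI : 0 < EI) (hL : 0 < L)
    (hF : 0 ≤ F) (hα : 0 ≤ α) (hα' : α < π) (hneg : ∀ x ∈ Ioc 0 L, beamCurvature L φ x < 0)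
    {x : ℝ} (hx : x ∈ Ioo 0 L) :
    √(1 - sin ((α + φ 0) / 2) ^ 2 * sin (elasticaAmplitude α φ x) ^ 2) =
      cos ((α + φ x) / 2) := by
  have hx' : x ∈ Icc 0 L := Ioo_subset_Icc_self hx
  have hπ := h.add_rotation_zero_lt_pi hEI hL hF hα' hneg
  have h0 := h.rotation_zero_pos hL hneg
  have hxnn := h.rotation_nonneg hneg hx'
  have hlt := h.strictAntiOn_rotation hneg (left_mem_Icc.2 hL.le) hx' hx.1
  have hk := sin_half_pos (by linarith) hπ
  have hs := sin_half_lt (ψ := α + φ x) (β := α + φ 0) (by linarith) (by linarith) hπ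
  have hs0 : 0 ≤ sin ((α + φ x) / 2) :=
    sin_nonneg_of_nonneg_of_le_pi (by linarith) (by linarith)
  rw [elasticaAmplitude, sin_arcsin (by linarith [div_nonneg hs0 hk.le])
    ((div_le_one hk).2 hs.le), ← mul_pow, mul_div_cancel₀ _ hk.ne', ← cos_sq',
    sqrt_sq (cos_half_pos (by linarith) (by linarith)).le]

/-- Restricted to the open interval because `arcsin` is not differentiable at 1, its argument at `x
= 0`. The root in its derivative cancels the one in the curvature. -/
theorem hasDerivAt_elasticaAmplitude (h : IsCantileverState EI L α F φ u w) (hEI : 0 < EI)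
    (hL : 0 < L) (hF : 0 ≤ F) (hα : 0 ≤ α) (hα' : α < π)
    (hneg : ∀ x ∈ Ioc 0 L, beamCurvature L φ x < 0) {x : ℝ} (hx : x ∈ Ioo 0 L) :
    HasDerivAt (elasticaAmplitude α φ) (-(√(F / EI) * cos ((α + φ x) / 2))) x := by
  have hx' : x ∈ Icc 0 L := Ioo_subset_Icc_self hx
  have hπ := h.add_rotation_zero_lt_pi hEI hL hF hα' hneg
  have h0 := h.rotation_zero_pos hL hneg
  have hxnn := h.rotation_nonneg hneg hx'
  have hlt := h.strictAntiOn_rotation hneg (left_mem_Icc.2 hL.le) hx' hx.1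
  have hk := sin_half_pos (by linarith) hπ
  have hs := sin_half_lt (ψ := α + φ x) (β := α + φ 0) (by linarith) (by linarith) hπ
  have hs0 : 0 ≤ sin ((α + φ x) / 2) :=
    sin_nonneg_of_nonneg_of_le_pi (by linarith) (by linarith)
  have hr1 : sin ((α + φ x) / 2) / sin ((α + φ 0) / 2) < 1 := (div_lt_one hk).2 hs
  have hr0 := div_nonneg hs0 hk.le
  have hsq : 0 < √(1 - (sin ((α + φ x) / 2) / sin ((α + φ 0) / 2)) ^ 2) :=
    sqrt_pos.2 (by nlinarith)
  have hd := (hasDerivAt_arcsin (by linarith) hr1.ne).comp x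
    ((((h.hasDerivAt_rotation hx).const_add α).div_const 2).sin.div_const (sin ((α + φ 0) / 2)))
  refine hd.congr_deriv ?_
  rw [h.momentCurvature_eq hEI hL hF hα hα' hneg (Ioo_subset_Ioc_self hx)]
  generalize √(1 - (sin ((α + φ x) / 2) / sin ((α + φ 0) / 2)) ^ 2) = r at hsq ⊢
  field_simp

theorem elasticaAmplitude_zero (h : 0 < sin ((α + φ 0) / 2)) :
    elasticaAmplitude α φ 0 = π / 2 := by
  rw [elasticaAmplitude, div_self h.ne', arcsin_one]

theorem elasticaAmplitude_length (h : IsCantileverState EI L α F φ u w) :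
    elasticaAmplitude α φ L = arcsin (sin (α / 2) / sin ((α + φ 0) / 2)) := by
  rw [elasticaAmplitude, h.clamped_rotation, add_zero]

/-! ### Length and end displacements -/

theorem length_mul_sqrt_eq (h : IsCantileverState EI L α F φ u w) (hEI : 0 < EI)
    (hL : 0 < L) (hF : 0 ≤ F) (hα : 0 ≤ α) (hα' : α < π)
    (hneg : ∀ x ∈ Ioc 0 L, beamCurvature L φ x < 0) :
    L * √(F / EI) = cantileverB α (φ 0) := by
  have hπ := h.add_rotation_zero_lt_pi hEI hL hF hα' hneg
  have h0 := h.rotation_zero_pos hL hneg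
  have hk2 := sin_half_sq_lt_one (ψ := α + φ 0) (by linarith) hπ
  have := eq_of_hasDerivAt_zero
    (f := fun x => ellipticFJ (elasticaAmplitude α φ x) (sin ((α + φ 0) / 2)) + √(F / EI) * x)
    hL.le
    (((continuous_ellipticFJ hk2).comp_continuousOn h.continuousOn_elasticaAmplitude).add
      (by fun_prop))
    fun x hx => by
      refine ((((hasDerivAt_ellipticFJ hk2 _).comp x
        (h.hasDerivAt_elasticaAmplitude hEI hL hF hα hα' hneg hx))).add
        ((hasDerivAt_id x).const_mul _)).congr_deriv ?_
      have hx' : x ∈ Icc 0 L := Ioo_subset_Icc_self hx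
      have hxnn := h.rotation_nonneg hneg hx'
      have hlt := h.strictAntiOn_rotation hneg (left_mem_Icc.2 hL.le) hx' hx.1
      have hc := cos_half_pos (ψ := α + φ x) (by linarith) (by linarith)
      rw [h.sqrt_elasticaAmplitude hEI hL hF hα hα' hneg hx]
      field_simp
      ring
  simp only [elasticaAmplitude_zero (sin_half_pos (by linarith) hπ),
    h.elasticaAmplitude_length, mul_zero, add_zero] at this
  rw [cantileverB_eq hα h0.le hπ.le, this]
  ring

/-- The derivative of `2 E_J(θ)` is `-2ω cos² ((α + φ) / 2) = -ω (1 + cos (α + φ))`, and `cos (α +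
φ)` is the derivative of `cos α * (u + x) + sin α * w`. -/
theorem sqrt_mul_displacement_along (h : IsCantileverState EI L α F φ u w) (hEI : 0 < EI)
    (hL : 0 < L) (hF : 0 ≤ F) (hα : 0 ≤ α) (hα' : α < π)
    (hneg : ∀ x ∈ Ioc 0 L, beamCurvature L φ x < 0) :
    √(F / EI) * (u 0 * cos α + w 0 * sin α) = √(F / EI) * (L * (1 + cos α)) -
      2 * (ellipticE (sin ((α + φ 0) / 2)) - cantileverD α (φ 0)) := by
  have hπ := h.add_rotation_zero_lt_pi hEI hL hF hα' hneg
  have h0 := h.rotation_zero_pos hL hneg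
  have := eq_of_hasDerivAt_zero
    (f := fun x => 2 * ellipticEJ (elasticaAmplitude α φ x) (sin ((α + φ 0) / 2)) +
      √(F / EI) * (x + (cos α * (u x + x) + sin α * w x)))
    hL.le
    ((continuousOn_const.mul
      ((continuous_ellipticEJ _).comp_continuousOn h.continuousOn_elasticaAmplitude)).add
      (continuousOn_const.mul (continuousOn_id.add ((continuousOn_const.mul
        (ContinuousOn.add (fun x hx => (h.beam.axial x hx).continuousWithinAt) continuousOn_id)).add
        (continuousOn_const.mul fun x hx => (h.beam.transversal x hx).continuousWithinAt)))))
    fun x hx => by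
      have hx' : x ∈ Icc 0 L := Ioo_subset_Icc_self hx
      have hn := Icc_mem_nhds hx.1 hx.2
      refine ((((hasDerivAt_ellipticEJ _ _).comp x
        (h.hasDerivAt_elasticaAmplitude hEI hL hF hα hα' hneg hx)).const_mul 2).add
        (((hasDerivAt_id x).add (((((h.beam.axial x hx').hasDerivAt hn).add
          (hasDerivAt_id x)).const_mul (cos α)).add
          (((h.beam.transversal x hx').hasDerivAt hn).const_mul
            (sin α)))).const_mul _)).congr_deriv ?_
      rw [h.sqrt_elasticaAmplitude hEI hL hF hα hα' hneg hx]
      have hc : cos α * cos (φ x) - sin α * sin (φ x) = 2 * cos ((α + φ x) / 2) ^ 2 - 1 := by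
        rw [← cos_add, cos_sq, mul_div_cancel₀ _ two_ne_zero]; ring
      linear_combination √(F / EI) * hc
  simp only [elasticaAmplitude_zero (sin_half_pos (by linarith) hπ),
    h.elasticaAmplitude_length, h.clamped_axial, h.clamped_transversal] at this
  rw [cantileverD_eq hα h0.le hπ.le, ellipticE]
  linarith

/-- No integration is needed: the moment at the clamp is affine in the displacement across the
force, while the first integral gives its square. Negative curvature selects the root. -/
theorem sqrt_mul_displacement_across (h : IsCantileverState EI L α F φ u w) (hEI : 0 < EI)
    (hL : 0 < L) (hF : 0 ≤ F) (hneg : ∀ x ∈ Ioc 0 L, beamCurvature L φ x < 0) :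
    √(F / EI) * (w 0 * cos α - u 0 * sin α) =
      √(2 * cos α - 2 * cos (α + φ 0)) - √(F / EI) * (L * sin α) := by
  have hF' := h.force_pos hL hF hneg
  have hω : 0 < √(F / EI) := sqrt_pos.2 (by positivity)
  have hω2 : √(F / EI) ^ 2 = F / EI := sq_sqrt (by positivity)
  have hlt := h.momentCurvature_neg hneg (right_mem_Ioc.2 hL)
  have hsq := h.momentCurvature_sq (right_mem_Icc.2 hL.le)
  have hp : momentCurvature EI α F u w L = -(√(F / EI) ^ 2 *
      (w 0 * cos α - u 0 * sin α + L * sin α)) := by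
    rw [hω2, momentCurvature, h.clamped_axial, h.clamped_transversal]
    ring
  rw [h.clamped_rotation, add_zero] at hsq
  have hpos : 0 < √(F / EI) * (w 0 * cos α - u 0 * sin α + L * sin α) := by
    refine (mul_pos_iff_of_pos_left hω).1 ?_
    nlinarith
  have : √(2 * cos α - 2 * cos (α + φ 0)) =
      √(F / EI) * (w 0 * cos α - u 0 * sin α + L * sin α) := by
    rw [sqrt_eq_iff_mul_self_eq_of_pos hpos]
    have hne := (sq_pos_of_pos hω).ne'
    refine mul_left_cancel₀ hne ?_
    rw [hp] at hsq
    linear_combination hsq - 2 * (cos α - cos (α + φ 0)) * hω2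
  linarith

end IsCantileverState

/-! ### Existence for a prescribed end rotation -/

theorem exists_cantileverState {EI L α φa : ℝ} (hEI : 0 < EI) (hL : 0 < L) (hα : 0 ≤ α)
    (hφa : 0 < φa) (hπ : α + φa < π) :
    ∃ φ u w : ℝ → ℝ, IsCantileverState EI L α (EI / L ^ 2 * cantileverB α φa ^ 2) φ u w ∧
      (∀ x ∈ Ioc 0 L, beamCurvature L φ x < 0) ∧ φ 0 = φa := by
  set k := sin ((α + φa) / 2) with hk
  set θL := arcsin (sin (α / 2) / k) with hθL
  have hk0 : 0 < k := sin_half_pos (by linarith) hπ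
  have hk2 : k ^ 2 < 1 := sin_half_sq_lt_one (by linarith) hπ
  have hB : cantileverB α φa = ellipticFJ (π / 2) k - ellipticFJ θL k :=
    cantileverB_eq hα hφa.le hπ.le
  have hB0 := cantileverB_pos hα hφa hπ
  obtain ⟨am, ham, ham_left, ham_deriv⟩ := exists_jacobi_amplitude hk2
  -- This is `√(F/EI)`; it makes the amplitude run from `π / 2` to exactly `θL` over the length `L`.
  set ω := cantileverB α φa / L with hω
  have hω0 : 0 < ω := by positivity
  have hFω : EI / L ^ 2 * cantileverB α φa ^ 2 / EI = ω ^ 2 := by rw [hω]; field_simp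
  set θ : ℝ → ℝ := fun x => am (ellipticFJ (π / 2) k - ω * x) with hθ
  set Δ : ℝ → ℝ := fun x => √(1 - k ^ 2 * sin (θ x) ^ 2) with hΔ
  have hΔ0 : ∀ x, 0 < Δ x := fun x => sqrt_pos.2 (one_sub_sq_mul_sin_sq_pos hk2 _)
  have hθ0 : θ 0 = π / 2 := by simp only [hθ, mul_zero, sub_zero, ham_left]
  have hθ_len : θ L = θL := by
    simp only [hθ, hω, div_mul_cancel₀ _ hL.ne', hB, sub_sub_cancel, ham_left]
  have hθ' : ∀ x, HasDerivAt θ (-(ω * Δ x)) x := fun x => by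
    refine ((ham_deriv _).comp x (((hasDerivAt_id x).const_mul ω).const_sub
      (ellipticFJ (π / 2) k))).congr_deriv ?_
    simp only [hΔ, hθ, id]; ring
  have hkθ : ∀ x, (k * sin (θ x)) ^ 2 < 1 := fun x => by
    rw [mul_pow]; linarith [one_sub_sq_mul_sin_sq_pos hk2 (θ x)]
  have hkθ' : ∀ x, -1 < k * sin (θ x) ∧ k * sin (θ x) < 1 := fun x =>
    abs_lt.1 ((sq_lt_one_iff_abs_lt_one _).1 (hkθ x))
  set φ : ℝ → ℝ := fun x => 2 * arcsin (k * sin (θ x)) - α with hφ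
  have hφ' : ∀ x, HasDerivAt φ (-(2 * k * ω * cos (θ x))) x := fun x => by
    have hd := (((hasDerivAt_arcsin (hkθ' x).1.ne' (hkθ' x).2.ne).comp x
      ((hθ' x).sin.const_mul k)).const_mul 2).sub_const α
    refine hd.congr_deriv ?_
    have hne := (hΔ0 x).ne'
    rw [mul_pow]
    change 2 * (1 / Δ x * _) = _
    field_simp
  have hφ_cont : Continuous φ := continuous_iff_continuousAt.2 fun x => (hφ' x).continuousAt
  have hsin : ∀ x, sin (α + φ x) = 2 * (k * sin (θ x)) * Δ x := fun x => by
    simp only [hφ, add_sub_cancel]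
    rw [sin_two_mul, sin_arcsin (hkθ' x).1.le (hkθ' x).2.le, cos_arcsin, mul_pow]
  -- Integrating from `L` builds in the clamping conditions.
  set u : ℝ → ℝ := fun x => ∫ t in L..x, (cos (φ t) - 1) with hu
  set w : ℝ → ℝ := fun x => ∫ t in L..x, -sin (φ t) with hw
  have hu' : ∀ x, HasDerivAt u (cos (φ x) - 1) x := fun x =>
    (by fun_prop : Continuous fun t => cos (φ t) - 1).integral_hasStrictDerivAt L x |>.hasDerivAt
  have hw' : ∀ x, HasDerivAt w (-sin (φ x)) x := fun x =>
    (by fun_prop : Continuous fun t => -sin (φ t)).integral_hasStrictDerivAt L x |>.hasDerivAt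
  -- The moment balance is not built in: the prescribed and actual curvatures agree because they
  -- have equal derivatives and both vanish at 0.
  have hmoment : ∀ x, 0 ≤ x →
      momentCurvature EI α (EI / L ^ 2 * cantileverB α φa ^ 2) u w x =
        -(2 * k * ω * cos (θ x)) := fun x hx => by
    have hd : ∀ y, HasDerivAt (fun y =>
        momentCurvature EI α (EI / L ^ 2 * cantileverB α φa ^ 2) u w y +
          2 * k * ω * cos (θ y)) 0 y := fun y => by
      have h1 := hasDerivWithinAt_univ.1 (hasDerivWithinAt_momentCurvature (EI := EI) (α := α)
        (F := EI / L ^ 2 * cantileverB α φa ^ 2)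
        (hu' y).hasDerivWithinAt (hw' y).hasDerivWithinAt)
      refine (h1.add ((hθ' y).cos.const_mul (2 * k * ω))).congr_deriv ?_
      rw [hFω, hsin]; ring
    have := eq_of_hasDerivAt_zero hx (fun y _ => (hd y).continuousAt.continuousWithinAt)
      fun y _ => hd y
    simp only [momentCurvature_zero, hθ0, cos_pi_div_two, mul_zero, add_zero] at this
    linarith
  refine ⟨φ, u, w, ⟨⟨fun x hx => ?_, fun x _ => (hu' x).hasDerivWithinAt,
    fun x _ => (hw' x).hasDerivWithinAt⟩, ?_, by simp [hu], by simp [hw]⟩, fun x hx => ?_, ?_⟩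
  · have h1 := hmoment x hx.1
    rw [neg_zero, zero_add]
    exact (hφ' x).hasDerivWithinAt.congr_deriv h1.symm
  · have hs : sin (α / 2) < k := sin_half_lt hα (by linarith) hπ
    have hs0 : 0 ≤ sin (α / 2) := sin_nonneg_of_nonneg_of_le_pi (by linarith) (by linarith)
    simp only [hφ, hθ_len, hθL]
    rw [sin_arcsin (by linarith [div_nonneg hs0 hk0.le]) ((div_le_one hk0).2 hs.le),
      mul_div_cancel₀ _ hk0.ne', arcsin_sin (by linarith [pi_pos]) (by linarith)]
    ring
  · have hx' : x ∈ Icc 0 L := Ioc_subset_Icc_self hx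
    rw [beamCurvature, (hφ' x).hasDerivWithinAt.derivWithin (uniqueDiffOn_Icc hL x hx')]
    -- On `(0, L]` the amplitude stays in `[0, π / 2)`, so `cos θ > 0` and the curvature is
    -- negative.
    have h1 : θ x < π / 2 := by
      rw [← hθ0]; exact ham (by nlinarith [hx.1])
    have h2 : 0 ≤ θ x := by
      refine le_trans ?_ ((hθ_len.symm.trans_le (ham.monotone (by nlinarith [hx.2]))))
      exact arcsin_nonneg.2
        (div_nonneg (sin_nonneg_of_nonneg_of_le_pi (by linarith) (by linarith)) hk0.le)
    have := cos_pos_of_mem_Ioo ⟨by linarith [pi_pos], h1⟩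
    have := mul_pos (mul_pos (mul_pos two_pos hk0) hω0) this
    linarith
  · simp only [hφ, hθ0, sin_pi_div_two, mul_one, hk]
    rw [arcsin_sin (by linarith) (by linarith)]
    ring

/-! ### Closed forms and axial compression -/

/-- The numerator `1 - cos 0` vanishes, and division by zero gives 0, so no range for `φ` is needed.
-/
theorem cantileverB_axial (φ : ℝ) : cantileverB 0 φ = ellipticK (sin (φ / 2)) := by
  simp [cantileverB, ellipticFJ_zero_left]

theorem cantileverD_axial (φ : ℝ) : cantileverD 0 φ = 0 := by
  simp [cantileverD, ellipticEJ_zero_left]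

theorem IsCantileverState.closed_form {EI L α F : ℝ} {φ u w : ℝ → ℝ}
    (h : IsCantileverState EI L α F φ u w) (hEI : 0 < EI)
    (hL : 0 < L) (hF : 0 ≤ F) (hα : 0 ≤ α) (hα' : α < π)
    (hneg : ∀ x ∈ Ioc 0 L, beamCurvature L φ x < 0) :
    F = EI / L ^ 2 * cantileverB α (φ 0) ^ 2 ∧
    u 0 = L * (1 + cos α)
      - L * sin α / cantileverB α (φ 0) * √(2 * cos α - 2 * cos (α + φ 0))
      - 2 * L * cos α / cantileverB α (φ 0)
        * (ellipticE (sin ((α + φ 0) / 2)) - cantileverD α (φ 0)) ∧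
    w 0 = L * sin α
      + L * cos α / cantileverB α (φ 0) * √(2 * cos α - 2 * cos (α + φ 0))
      - 2 * L * sin α / cantileverB α (φ 0)
        * (ellipticE (sin ((α + φ 0) / 2)) - cantileverD α (φ 0)) ∧
    u 0 * cos α + w 0 * sin α = L * (1 + cos α)
      - 2 * L / cantileverB α (φ 0)
        * (ellipticE (sin ((α + φ 0) / 2)) - cantileverD α (φ 0)) := by
  have hlen := h.length_mul_sqrt_eq hEI hL hF hα hα' hneg
  have halong := h.sqrt_mul_displacement_along hEI hL hF hα hα' hneg
  have hacross := h.sqrt_mul_displacement_across hEI hL hF hneg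
  have hω : 0 < √(F / EI) := sqrt_pos.2 (div_pos (h.force_pos hL hF hneg) hEI)
  have hω2 : √(F / EI) ^ 2 = F / EI := sq_sqrt (by positivity)
  rw [← hlen]
  refine ⟨by rw [mul_pow, hω2]; field_simp, ?_⟩
  generalize ellipticE (sin ((α + φ 0) / 2)) - cantileverD α (φ 0) = Q at *
  generalize √(2 * cos α - 2 * cos (α + φ 0)) = S at *
  generalize √(F / EI) = ω at *
  have hsc := sin_sq_add_cos_sq α
  -- Rotating the along and across components back by `α` recovers `u 0` and `w 0`.
  refine ⟨?_, ?_, ?_⟩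
  · field_simp
    linear_combination cos α * halong - sin α * hacross + ω * (L - u 0) * hsc
  · field_simp
    linear_combination sin α * halong + cos α * hacross - ω * w 0 * hsc
  · field_simp
    linear_combination halong

theorem IsCantileverState.axial_closed_form {EI L F : ℝ} {φ u w : ℝ → ℝ}
    (h : IsCantileverState EI L 0 F φ u w) (hEI : 0 < EI) (hL : 0 < L) (hF : 0 ≤ F)
    (hneg : ∀ x ∈ Ioc 0 L, beamCurvature L φ x < 0) :
    F = axialForce EI L (φ 0) ∧ u 0 = axialU L (φ 0) ∧ w 0 = axialW L (φ 0) := by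
  have h0 := h.rotation_zero_pos hL hneg
  have hπ := h.add_rotation_zero_lt_pi hEI hL hF pi_pos hneg
  obtain ⟨hFe, hu, hw, -⟩ := h.closed_form hEI hL hF le_rfl pi_pos hneg
  rw [zero_add] at hπ
  have hS : √(2 - 2 * cos (φ 0)) = 2 * sin (φ 0 / 2) := by
    rw [← sqrt_sq (mul_pos two_pos (sin_half_pos h0 hπ)).le, mul_pow, sin_sq_eq_half_sub,
      mul_div_cancel₀ _ two_ne_zero]
    ring_nf
  simp only [cantileverB_axial, cantileverD_axial, zero_add, cos_zero, sin_zero, mul_one,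
    hS] at hFe hu hw
  refine ⟨hFe, ?_, ?_⟩
  · rw [hu, axialU]; ring
  · rw [hw, axialW]; ring

theorem continuousAt_ellipticK_sin_half : ContinuousAt (fun φ : ℝ => ellipticK (sin (φ / 2))) 0 :=
  ContinuousAt.comp (g := ellipticK) (f := fun φ : ℝ => sin (φ / 2))
    (by simpa using continuousAt_ellipticK_zero) (by fun_prop)

theorem ellipticK_sin_half_zero_ne : ellipticK (sin (0 / 2)) ≠ 0 := by
  simp [ellipticK_zero, pi_ne_zero]

theorem continuousAt_axialForce (EI L : ℝ) : ContinuousAt (axialForce EI L) 0 :=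
  continuousAt_const.mul (continuousAt_ellipticK_sin_half.pow 2)

theorem continuousAt_axialU (L : ℝ) : ContinuousAt (axialU L) 0 :=
  continuousAt_const.mul (continuousAt_const.sub
    ((continuous_ellipticE.comp (by fun_prop : Continuous fun φ : ℝ => sin (φ / 2))).continuousAt.div
      continuousAt_ellipticK_sin_half ellipticK_sin_half_zero_ne))

theorem continuousAt_axialW (L : ℝ) : ContinuousAt (axialW L) 0 :=
  ContinuousAt.div (by fun_prop) continuousAt_ellipticK_sin_half ellipticK_sin_half_zero_ne

end

theorem mainTheorem3 (EI L : ℝ) (hEI : 0 < EI) (hL : 0 < L) :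
    -- inclined force: every state with negative curvature obeys the closed-form relations
    (∀ α ∈ Set.Ico 0 Real.pi, ∀ F : ℝ, 0 ≤ F → ∀ φ u w : ℝ → ℝ,
      IsCantileverState EI L α F φ u w →
      (∀ x ∈ Set.Ioc 0 L, beamCurvature L φ x < 0) →
        0 < φ 0 ∧ α + φ 0 < Real.pi ∧ 0 < cantileverB α (φ 0) ∧
        L * Real.sqrt (F / EI) = cantileverB α (φ 0) ∧
        F = EI / L ^ 2 * cantileverB α (φ 0) ^ 2 ∧
        u 0 = L * (1 + Real.cos α)
          - L * Real.sin α / cantileverB α (φ 0)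
            * Real.sqrt (2 * Real.cos α - 2 * Real.cos (α + φ 0))
          - 2 * L * Real.cos α / cantileverB α (φ 0)
            * (ellipticE (Real.sin ((α + φ 0) / 2)) - cantileverD α (φ 0)) ∧
        w 0 = L * Real.sin α
          + L * Real.cos α / cantileverB α (φ 0)
            * Real.sqrt (2 * Real.cos α - 2 * Real.cos (α + φ 0))
          - 2 * L * Real.sin α / cantileverB α (φ 0)
            * (ellipticE (Real.sin ((α + φ 0) / 2)) - cantileverD α (φ 0)) ∧
        u 0 * Real.cos α + w 0 * Real.sin α = L * (1 + Real.cos α)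
          - 2 * L / cantileverB α (φ 0)
            * (ellipticE (Real.sin ((α + φ 0) / 2)) - cantileverD α (φ 0))) ∧
    -- the end rotation parametrizes these states
    (∀ α ∈ Set.Ico 0 Real.pi, ∀ φa : ℝ, 0 < φa → α + φa < Real.pi → ∀ F : ℝ, 0 ≤ F →
      ((∃ φ u w : ℝ → ℝ, IsCantileverState EI L α F φ u w ∧
          (∀ x ∈ Set.Ioc 0 L, beamCurvature L φ x < 0) ∧ φ 0 = φa) ↔
        F = EI / L ^ 2 * cantileverB α φa ^ 2)) ∧
    -- axial compression
    (∀ φa ∈ Set.Ioo 0 Real.pi,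
      cantileverB 0 φa = ellipticK (Real.sin (φa / 2)) ∧ cantileverD 0 φa = 0) ∧
    (∀ F : ℝ, 0 ≤ F → ∀ φ u w : ℝ → ℝ,
      IsCantileverState EI L 0 F φ u w →
      (∀ x ∈ Set.Ioc 0 L, beamCurvature L φ x < 0) →
        F = axialForce EI L (φ 0) ∧ u 0 = axialU L (φ 0) ∧ w 0 = axialW L (φ 0)) ∧
    -- no singularity at zero end rotation, where the Euler load is recovered
    ellipticK 0 = Real.pi / 2 ∧ ellipticE 0 = Real.pi / 2 ∧
    ContinuousAt (axialForce EI L) 0 ∧ ContinuousAt (axialU L) 0 ∧ ContinuousAt (axialW L) 0 ∧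
    axialForce EI L 0 = EI * Real.pi ^ 2 / (4 * L ^ 2) ∧ axialU L 0 = 0 ∧ axialW L 0 = 0 := by
  refine ⟨fun α hα F hF φ u w h hneg => ?_, fun α hα φa hφa hπ F hF => ⟨?_, ?_⟩,
    fun φa _ => ⟨cantileverB_axial φa, cantileverD_axial φa⟩,
    fun F hF φ u w h hneg => h.axial_closed_form hEI hL hF hneg,
    ellipticK_zero, ellipticE_zero, continuousAt_axialForce EI L, continuousAt_axialU L,
    continuousAt_axialW L, ?_, ?_, ?_⟩
  · have h0 := h.rotation_zero_pos hL hneg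
    have hπ := h.add_rotation_zero_lt_pi hEI hL hF hα.2 hneg
    exact ⟨h0, hπ, cantileverB_pos hα.1 h0 hπ, h.length_mul_sqrt_eq hEI hL hF hα.1 hα.2 hneg,
      h.closed_form hEI hL hF hα.1 hα.2 hneg⟩
  · rintro ⟨φ, u, w, h, hneg, rfl⟩
    exact (h.closed_form hEI hL hF hα.1 hα.2 hneg).1
  · rintro rfl
    exact exists_cantileverState hEI hL hα.1 hφa hπ
  · rw [axialForce, zero_div, Real.sin_zero, ellipticK_zero]
    field_simp
    ring
  · simp [axialU, ellipticK_zero, ellipticE_zero, Real.pi_ne_zero]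
  · simp [axialW]
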